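/- Let $B=\{B_t,\ t\ge 0\}$ be a centered Gaussian process with stationary increments and $B_0=0$ a.s., let $T>0$, and for $\theta\in\mathbb R$ put $X_t=\theta t+B_t$, $t\in[0,T]$. Assume: 1. all finite-dimensional distributions of $\{B_t,\ t\in(0,T]\}$ are nonsingular, that is, for any distinct $t_1,\dots,t_N\in(0,T]$ the covariance matrix of $(B_{t_1},\dots,B_{t_N})$ is nonsingular; 2. there is an even function $K\in L_1[-T,T]$ such that on $[0,T]^2$ the covariance function $R(t,s)=\mathsf E\,B_tB_s$ has the mixed derivative $\frac{\partial^2}{\partial s\,\partial t}R(t,s)=K(t-s)$, where each derivative is understood in the sense of absolutely continuous functions: for every $s$ the function $R(\cdot,s)$ is absolutely continuous on $[0,T]$ with a.e. derivative $D(\cdot,s)$, and for almost every $t$ the function $D(t,\cdot)$ is absolutely continuous on $[0,T]$ with a.e. derivative $K(t-\cdot)$; 3. $h_T\in L_2[0,T]$ satisfies $\Gamma_Th_T=1$, where $\Gamma_Tf(t)=\int_0^TK(t-s)f(s)\,ds$; that is, $\int_0^TK(t-s)h_T(s)\,ds=1$ for almost every $t\in[0,T]$. Then the integral $\int_0^Th_T(s)\,dB_s$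 exists as the mean square limit of the sums $\sum_{k=1}^{n}c_k\,(B_{t_k}-B_{t_{k-1}})$, $0=t_0<\dots<t_n=T$, as the step functions $\sum_{k=1}^{n}c_k\mathbf 1_{(t_{k-1},t_k]}$ converge to $h_T$ in $L_2[0,T]$. It is a.s. equal to $\Phi\big((B_t)_{t\in[0,T]}\big)$ for a measurable functional $\Phi$ on the space $\mathbb R^{[0,T]}$ with the $\sigma$-algebra generated by the cylinder sets. Moreover, if $P_\theta$ denotes the law of $(X_t)_{t\in[0,T]}$ on this space for the parameter value $\theta$, then for every $\theta\in\mathbb R$ $$\frac{dP_\theta}{dP_0}(x)=\exp\Big\{\theta\,\Phi(x)-\frac{\theta^2}{2}\int_0^Th_T(s)\,ds\Big\},$$ i.e. $P_\theta$ is absolutely continuous with respect to $P_0$ and $L(\theta)=\exp\big\{\theta\int_0^Th_T(s)\,dB_s-\frac{\theta^2}{2}\int_0^Th_T(s)\,ds\big\}$, viewed as a functional of the path, is its Radon–Nikodym density (the likelihood function). -/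

import Mathlib

open MeasureTheory ProbabilityTheory Set
open scoped NNReal ENNReal

noncomputable section

namespace GaussDrift

/-- Stationary increments: for every `h ≥ 0`, the process `t ↦ B (t + h) - B h` has the same
finite-dimensional distributions as `t ↦ B t - B 0`. -/
def HasStationaryIncrements {Ω : Type*} [MeasurableSpace Ω] (B : ℝ≥0 → Ω → ℝ) (P : Measure Ω) :
    Prop :=
  ∀ (h : ℝ≥0) (n : ℕ) (t : Fin n → ℝ≥0),
    IdentDistrib (fun ω i => B (t i + h) ω - B h ω) (fun ω i => B (t i) ω - B 0 ω) P P

/-- All finite-dimensional distributions of `(B t)`, `t ∈ (0, T]`, are nonsingular, i.e. the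
covariance matrix of `(B t)_{t ∈ I}` is nonsingular for each finite set `I ⊆ (0, T]`. -/
def NonsingularFDD {Ω : Type*} [MeasurableSpace Ω] (B : ℝ≥0 → Ω → ℝ) (P : Measure Ω)
    (T : ℝ≥0) : Prop :=
  ∀ I : Finset ℝ≥0, (I : Set ℝ≥0) ⊆ Ioc 0 T →
    (Matrix.of fun i j : I => cov[B i, B j; P]).det ≠ 0

/-- The covariance function `(t, s) ↦ E[B t * B s]` of a centered process, with real time
arguments (only the values for `t, s ≥ 0` matter). -/
def covFun {Ω : Type*} [MeasurableSpace Ω] (B : ℝ≥0 → Ω → ℝ) (P : Measure Ω) (t s : ℝ) : ℝ :=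
  ∫ ω, B t.toNNReal ω * B s.toNNReal ω ∂P

/-- `∂²R / ∂s ∂t = k` on `[0, T]²`, for an integrable (possibly unbounded) kernel `k`.
Each of the two successive derivatives is taken in the sense of absolutely continuous functions:
for every `s`, the function `R(·, s)` is absolutely continuous with almost everywhere derivative
`D(·, s) = ∂R/∂t (·, s)`; and for almost every `t`, the function `D(t, ·)` is absolutely continuous
with almost everywhere derivative `k(t, ·)`. -/
def HasMixedDeriv (R k : ℝ → ℝ → ℝ) (T : ℝ) : Prop :=
  ∃ D : ℝ → ℝ → ℝ,
    (∀ s ∈ Icc 0 T, AbsolutelyContinuousOnInterval (fun t => R t s) 0 T ∧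
      ∀ᵐ t ∂(volume.restrict (Icc 0 T)), HasDerivAt (fun t => R t s) (D t s) t) ∧
    (∀ᵐ t ∂(volume.restrict (Icc 0 T)), AbsolutelyContinuousOnInterval (D t) 0 T ∧
      ∀ᵐ s ∂(volume.restrict (Icc 0 T)), HasDerivAt (D t) (k t s) s)

/-- The operator `(Γ_T f)(t) = ∫_0^T K(t - s) f(s) ds`. -/
def gammaOp (K : ℝ → ℝ) (T : ℝ) (f : ℝ → ℝ) (t : ℝ) : ℝ :=
  ∫ s in Icc 0 T, K (t - s) * f s

/-- `0 = t_0 < t_1 < … < t_n = T`. -/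
def IsPartition (T : ℝ≥0) {n : ℕ} (t : Fin (n + 1) → ℝ≥0) : Prop :=
  StrictMono t ∧ t 0 = 0 ∧ t (Fin.last n) = T

/-- The step function equal to `c k` on `(t_k, t_{k+1}]`. -/
def stepFun {n : ℕ} (t : Fin (n + 1) → ℝ≥0) (c : Fin n → ℝ) (s : ℝ) : ℝ :=
  ∑ k : Fin n, (Ioc (t k.castSucc : ℝ) (t k.succ : ℝ)).indicator (fun _ => c k) s

/-- The Riemann sum `∑ c k * (B t_{k+1} - B t_k)`. -/
def riemannSum {Ω : Type*} (B : ℝ≥0 → Ω → ℝ) {n : ℕ} (t : Fin (n + 1) → ℝ≥0) (c : Fin n → ℝ)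
    (ω : Ω) : ℝ :=
  ∑ k : Fin n, c k * (B (t k.succ) ω - B (t k.castSucc) ω)

/-- `J` is (a version of) the integral `∫_0^T f dB` of `f ∈ L²[0, T]`: the mean square limit of
the Riemann sums `∑ c k * (B t_{k+1} - B t_k)` as the corresponding step functions converge
to `f` in `L²[0, T]`. -/
def IsIntegral {Ω : Type*} [MeasurableSpace Ω] (B : ℝ≥0 → Ω → ℝ) (P : Measure Ω) (T : ℝ≥0)
    (f : ℝ → ℝ) (J : Ω → ℝ) : Prop :=
  MemLp J 2 P ∧
  ∀ ε : ℝ≥0∞, 0 < ε → ∃ δ : ℝ≥0∞, 0 < δ ∧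
    ∀ (n : ℕ) (t : Fin (n + 1) → ℝ≥0) (c : Fin n → ℝ), IsPartition T t →
      eLpNorm (fun s => f s - stepFun t c s) 2 (volume.restrict (Icc 0 (T : ℝ))) < δ →
      eLpNorm (fun ω => J ω - riemannSum B t c ω) 2 P < ε

/-- The path on `[0, T]` of the process `X t = θ t + B t`. -/
def pathX {Ω : Type*} (B : ℝ≥0 → Ω → ℝ) (T : ℝ≥0) (θ : ℝ) (ω : Ω) : Iic T → ℝ :=
  fun t => θ * ((t : ℝ≥0) : ℝ) + B t ω

/-- The law of `X t = θ t + B t`, `t ∈ [0, T]`, on the space of paths with the `σ`-algebra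
generated by the cylinder sets. -/
def lawX {Ω : Type*} [MeasurableSpace Ω] (B : ℝ≥0 → Ω → ℝ) (P : Measure Ω) (T : ℝ≥0) (θ : ℝ) :
    Measure (Iic T → ℝ) :=
  P.map (pathX B T θ)

end GaussDrift

end

/-!
Let `J = ∫₀ᵀ h dB`. The equation `Γ h = 1` says exactly that `J` has covariance `t` with `B t` for
every `t ∈ [0, T]` (`integral_mul_isIntegral`), and hence variance `∫ h`
(`integral_isIntegral_mul_self`). So `J` represents the drift `t ↦ t` in the Gaussian Hilbert space
of the process, and the density is the one of the Cameron–Martin theorem.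

Existence of `J`: integrating the mixed derivative twice (`covFun_eq_integral`), the second moment
of the sum attached to a step function `f` is `∫∫ K (t - s) f t f s`, which by Schur's test is at
most `‖K‖₁ ‖f‖₂²` (`integral_sumOf_sq_le`). The map from step functions to sums is therefore bounded
for the mean square norms, and step functions are dense in `L²[0, T]`
(`exists_stepFun_eLpNorm_sub_lt`). An almost surely convergent subsequence of the sums makes `J`
a measurable functional of the path (`IsIntegral.exists_functional`).

Density: put `v = Var J`, which is nonzero because `J` has covariance `T` with `B T`. The process
`Y t = B t - (t / v) J` is jointly Gaussian with `J` (mean square limits of Gaussian processes are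
Gaussian) and uncorrelated with it, hence independent of it. Tilting by `exp (θ J - θ² v / 2)`
moves the law `N(0, v)` of `J` to `N(θ v, v)` and leaves `Y` unchanged, so it replaces `J` by
`J + θ v` in law, that is, `B t = Y t + (t / v) J` by `B t + θ t` (`lawX_eq_withDensity`).
-/

namespace GaussDrift

/-! ### Integral estimates for a difference kernel -/

lemma integrable_mul_kernel {K F : ℝ → ℝ} {T : ℝ}
    (hK : IntegrableOn K (Icc (-T) T)) (hF : IntegrableOn F (Icc 0 T)) :
    Integrable (fun p : ℝ × ℝ => F p.2 * K (p.1 - p.2))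
      ((volume.restrict (Icc 0 T)).prod (volume.restrict (Icc 0 T))) := by
  rw [Measure.prod_restrict]
  have h := Integrable.convolution_integrand (ContinuousLinearMap.mul ℝ ℝ)
    ((integrable_indicator_iff measurableSet_Icc).2 hF)
    ((integrable_indicator_iff measurableSet_Icc).2 hK)
  refine (h.integrableOn (s := Icc 0 T ×ˢ Icc 0 T)).congr_fun ?_
    (measurableSet_Icc.prod measurableSet_Icc)
  rintro ⟨a, b⟩ ⟨ha, hb⟩
  have hab : a - b ∈ Icc (-T) T := by
    simp only [mem_Icc] at ha hb ⊢; constructor <;> linarith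
  simp [indicator_of_mem hab, indicator_of_mem hb]

lemma integral_abs_kernel_le {K : ℝ → ℝ} {T w : ℝ}
    (hK : IntegrableOn K (Icc (-T) T)) (hw : w ∈ Icc 0 T) :
    ∫ u in Icc 0 T, |K (u - w)| ≤ ∫ v in Icc (-T) T, |K v| := by
  have hi : Integrable ((Icc (-T) T).indicator fun v => |K v|) :=
    (integrable_indicator_iff measurableSet_Icc).2 hK.abs
  calc ∫ u in Icc 0 T, |K (u - w)|
      = ∫ u in Icc 0 T, (Icc (-T) T).indicator (fun v => |K v|) (u - w) := by
        refine setIntegral_congr_fun measurableSet_Icc fun u hu => ?_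
        have : u - w ∈ Icc (-T) T := by
          simp only [mem_Icc] at hu hw ⊢; constructor <;> linarith
        simp [indicator_of_mem this]
    _ ≤ ∫ u, (Icc (-T) T).indicator (fun v => |K v|) (u - w) :=
        setIntegral_le_integral (hi.comp_sub_right w)
          (ae_of_all _ fun u => indicator_nonneg (fun _ _ => abs_nonneg _) _)
    _ = ∫ v in Icc (-T) T, |K v| := by
        rw [integral_sub_right_eq_self, integral_indicator measurableSet_Icc]

lemma integral_abs_mul_kernel_le {K F : ℝ → ℝ} {T : ℝ}
    (hK : IntegrableOn K (Icc (-T) T)) (hF : IntegrableOn F (Icc 0 T)) :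
    ∫ p, |F p.2 * K (p.1 - p.2)|
        ∂((volume.restrict (Icc 0 T)).prod (volume.restrict (Icc 0 T)))
      ≤ (∫ v in Icc (-T) T, |K v|) * ∫ u in Icc 0 T, |F u| := by
  rw [integral_prod_symm _ (integrable_mul_kernel hK hF).abs, ← integral_const_mul]
  refine integral_mono_ae ((integrable_mul_kernel hK hF).abs.integral_prod_right)
    (hF.abs.const_mul _) ?_
  filter_upwards [ae_restrict_mem measurableSet_Icc] with w hw
  simp only [abs_mul, integral_const_mul]
  rw [mul_comm]
  exact mul_le_mul_of_nonneg_right (integral_abs_kernel_le hK hw) (abs_nonneg _)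

/-- Schur's test, in the form needed for the diagonal of the quadratic form of the convolution
operator with an even kernel: pointwise, `|K f(u) f(v)| ≤ |K| (f(u)² + f(v)²) / 2`. -/
lemma integral_kernel_mul_mul_le {K f : ℝ → ℝ} {T : ℝ} (hK_even : ∀ x, K (-x) = K x)
    (hK : IntegrableOn K (Icc (-T) T)) (hf : MemLp f 2 (volume.restrict (Icc 0 T))) :
    ∫ p : ℝ × ℝ, K (p.1 - p.2) * (f p.1 * f p.2)
        ∂((volume.restrict (Icc 0 T)).prod (volume.restrict (Icc 0 T)))
      ≤ (∫ v in Icc (-T) T, |K v|) * ∫ u in Icc 0 T, f u ^ 2 := by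
  set μ := volume.restrict (Icc (0 : ℝ) T)
  have hf2 : IntegrableOn (fun u => f u ^ 2) (Icc 0 T) := hf.integrable_sq
  have h1 := integrable_mul_kernel hK hf2
  have h1' : Integrable (fun p : ℝ × ℝ => f p.1 ^ 2 * K (p.1 - p.2)) (μ.prod μ) := by
    refine h1.swap.congr (ae_of_all _ fun p => ?_)
    simp only [Function.comp, Prod.swap, ← hK_even (p.1 - p.2), neg_sub]
  have hle := integral_abs_mul_kernel_le hK hf2
  have hle' : ∫ p, |f p.1 ^ 2 * K (p.1 - p.2)| ∂(μ.prod μ)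
      ≤ (∫ v in Icc (-T) T, |K v|) * ∫ u in Icc 0 T, |f u ^ 2| := by
    rw [← integral_prod_swap]
    refine le_of_eq_of_le (integral_congr_ae (ae_of_all _ fun p => ?_)) hle
    simp only [Prod.swap, ← hK_even (p.1 - p.2), neg_sub]
  simp only [abs_of_nonneg (sq_nonneg (f _))] at hle hle'
  have key : ∫ p : ℝ × ℝ, K (p.1 - p.2) * (f p.1 * f p.2) ∂(μ.prod μ)
      ≤ ∫ p : ℝ × ℝ, (1 / 2) * (|f p.2 ^ 2 * K (p.1 - p.2)| + |f p.1 ^ 2 * K (p.1 - p.2)|)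
        ∂(μ.prod μ) := by
    refine (le_abs_self _).trans (abs_integral_le_integral_abs.trans ?_)
    refine integral_mono_of_nonneg (ae_of_all _ fun p => abs_nonneg _)
      ((h1.abs.add h1'.abs).const_mul (1 / 2)) (ae_of_all _ fun p => ?_)
    have h2 : |f p.1 * f p.2| ≤ (f p.1 ^ 2 + f p.2 ^ 2) / 2 :=
      abs_le.2 ⟨by nlinarith [sq_nonneg (f p.1 + f p.2)], by nlinarith [sq_nonneg (f p.1 - f p.2)]⟩
    simp only [abs_mul, abs_pow, sq_abs] at h2 ⊢
    nlinarith [mul_le_mul_of_nonneg_left h2 (abs_nonneg (K (p.1 - p.2)))]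
  refine key.trans ?_
  rw [integral_const_mul, integral_add h1.abs h1'.abs]
  linarith

/-! ### The covariance function as a double integral of the kernel -/

/-- The fundamental theorem of calculus for absolutely continuous functions, used twice: the boundary
terms vanish because `B 0 = 0`. -/
lemma covFun_eq_integral {Ω : Type*} [MeasurableSpace Ω] {P : Measure Ω} {B : ℝ≥0 → Ω → ℝ}
    (hB_zero : ∀ᵐ ω ∂P, B 0 ω = 0) {T : ℝ} {K : ℝ → ℝ}
    (hK_cov : HasMixedDeriv (covFun B P) (fun t s => K (t - s)) T)
    {t s : ℝ} (ht : t ∈ Icc 0 T) (hs : s ∈ Icc 0 T) :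
    covFun B P t s = ∫ u in Ioc 0 t, ∫ w in Ioc 0 s, K (u - w) := by
  obtain ⟨D, hD1, hD2⟩ := hK_cov
  have hT : 0 ≤ T := ht.1.trans ht.2
  have hzl : ∀ s, covFun B P 0 s = 0 := fun s => by
    refine integral_eq_zero_of_ae ?_
    filter_upwards [hB_zero] with ω hω
    simp [hω]
  have hzr : ∀ t, covFun B P t 0 = 0 := fun s => by
    refine integral_eq_zero_of_ae ?_
    filter_upwards [hB_zero] with ω hω
    simp [hω]
  have hD0 : ∀ᵐ u ∂(volume.restrict (Icc 0 T)), D u 0 = 0 := by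
    filter_upwards [(hD1 0 ⟨le_rfl, hT⟩).2] with u hu
    simp only [hzr] at hu
    exact hu.unique (hasDerivAt_const u 0)
  have hDs : ∀ᵐ u ∂(volume.restrict (Icc 0 T)), D u s = ∫ w in Ioc 0 s, K (u - w) := by
    filter_upwards [hD0, hD2] with u hu0 hu
    have hac : AbsolutelyContinuousOnInterval (D u) 0 s := hu.1.mono (by
      rw [uIcc_of_le hs.1, uIcc_of_le hT]; exact Icc_subset_Icc_right hs.2)
    have := hac.integral_deriv_eq_sub
    rw [hu0, sub_zero, intervalIntegral.integral_of_le hs.1] at this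
    rw [← this]
    refine integral_congr_ae ?_
    filter_upwards [ae_restrict_of_ae_restrict_of_subset
      (Ioc_subset_Icc_self.trans (Icc_subset_Icc_right hs.2)) hu.2] with w hw
    exact hw.deriv
  have hac : AbsolutelyContinuousOnInterval (fun t => covFun B P t s) 0 t :=
    (hD1 s hs).1.mono (by
      rw [uIcc_of_le ht.1, uIcc_of_le hT]; exact Icc_subset_Icc_right ht.2)
  have := hac.integral_deriv_eq_sub
  rw [hzl, sub_zero, intervalIntegral.integral_of_le ht.1] at this
  rw [← this]
  have hsub : Ioc 0 t ⊆ Icc 0 T := Ioc_subset_Icc_self.trans (Icc_subset_Icc_right ht.2)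
  refine integral_congr_ae ?_
  filter_upwards [ae_restrict_of_ae_restrict_of_subset hsub hDs,
    ae_restrict_of_ae_restrict_of_subset hsub (hD1 s hs).2] with u hu hu'
  rw [hu'.deriv, hu]

/-! ### Finite linear combinations of the values of the process -/

/-- The step function `∑ x a • 𝟙_(0, a]` attached to a finitely supported family `x` of
coefficients. -/
noncomputable def stepOf (T : ℝ≥0) : (Iic T →₀ ℝ) →ₗ[ℝ] (ℝ → ℝ) :=
  Finsupp.linearCombination ℝ fun a => (Ioc (0 : ℝ) (a : ℝ≥0)).indicator 1

/-- The linear combination `∑ x a • Z a` of the values of a process indexed by `[0, T]`. -/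
noncomputable def sumOf {Ω : Type*} {T : ℝ≥0} (Z : Iic T → Ω → ℝ) :
    (Iic T →₀ ℝ) →ₗ[ℝ] (Ω → ℝ) :=
  Finsupp.linearCombination ℝ Z

lemma measurable_stepOf {T : ℝ≥0} (x : Iic T →₀ ℝ) : Measurable (stepOf T x) := by
  induction x using Finsupp.induction_linear with
  | zero => simpa using measurable_zero
  | add x y hx hy => rw [map_add]; exact hx.add hy
  | single a c =>
    rw [stepOf, Finsupp.linearCombination_single]
    exact (measurable_one.indicator measurableSet_Ioc).const_smul c

lemma exists_abs_stepOf_le {T : ℝ≥0} (x : Iic T →₀ ℝ) : ∃ M, ∀ u, |stepOf T x u| ≤ M := by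
  induction x using Finsupp.induction_linear with
  | zero => exact ⟨0, by simp⟩
  | add x y hx hy =>
    obtain ⟨M, hM⟩ := hx
    obtain ⟨N, hN⟩ := hy
    refine ⟨M + N, fun u => ?_⟩
    rw [map_add]
    exact (abs_add_le _ _).trans (add_le_add (hM u) (hN u))
  | single a c =>
    refine ⟨|c|, fun u => ?_⟩
    rw [stepOf, Finsupp.linearCombination_single]
    simp only [Pi.smul_apply, smul_eq_mul, abs_mul, indicator_apply, Pi.one_apply]
    split_ifs <;> simp

lemma memLp_stepOf {T : ℝ≥0} (x : Iic T →₀ ℝ) {p : ℝ≥0∞} {s : Set ℝ}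
    [IsFiniteMeasure (volume.restrict s)] : MemLp (stepOf T x) p (volume.restrict s) := by
  obtain ⟨M, hM⟩ := exists_abs_stepOf_le x
  exact .of_bound (measurable_stepOf x).aestronglyMeasurable M (ae_of_all _ hM)

lemma memLp_sumOf {Ω : Type*} [MeasurableSpace Ω] {P : Measure Ω} {T : ℝ≥0} {Z : Iic T → Ω → ℝ}
    {p : ℝ≥0∞} (hZ : ∀ a, MemLp (Z a) p P) (x : Iic T →₀ ℝ) : MemLp (sumOf Z x) p P := by
  induction x using Finsupp.induction_linear with
  | zero => simp
  | add x y hx hy => rw [map_add]; exact hx.add hy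
  | single a c => rw [sumOf, Finsupp.linearCombination_single]; exact (hZ a).const_smul c

lemma integrable_kernel_mul_stepOf {K : ℝ → ℝ} {T : ℝ≥0}
    (hK : IntegrableOn K (Icc (-(T : ℝ)) T)) (x y : Iic T →₀ ℝ) :
    Integrable (fun p : ℝ × ℝ => K (p.1 - p.2) * (stepOf T x p.1 * stepOf T y p.2))
      ((volume.restrict (Icc 0 (T : ℝ))).prod (volume.restrict (Icc 0 (T : ℝ)))) := by
  obtain ⟨M, hM⟩ := exists_abs_stepOf_le x
  have h1 := integrable_mul_kernel hK
    ((memLp_one_iff_integrable.1 (memLp_stepOf y (p := 1) (s := Icc 0 (T : ℝ)))))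
  refine (h1.bdd_mul (c := M) ((measurable_stepOf x).comp measurable_fst).aestronglyMeasurable
    (ae_of_all _ fun p => hM p.1)).congr (ae_of_all _ fun p => ?_)
  simp only [Function.comp]
  ring

/-- The covariance of two linear combinations of values of the process is the bilinear form of
the kernel at the corresponding step functions. -/
lemma integral_sumOf_mul_sumOf {Ω : Type*} [MeasurableSpace Ω] {P : Measure Ω} {B : ℝ≥0 → Ω → ℝ}
    {T : ℝ≥0} (hB : ∀ t, MemLp (B t) 2 P)
    (hB_zero : ∀ᵐ ω ∂P, B 0 ω = 0) {K : ℝ → ℝ}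
    (hK : IntegrableOn K (Icc (-(T : ℝ)) T))
    (hK_cov : HasMixedDeriv (covFun B P) (fun t s => K (t - s)) T) (x y : Iic T →₀ ℝ) :
    ∫ ω, sumOf (fun a : Iic T => B a) x ω * sumOf (fun a : Iic T => B a) y ω ∂P =
      ∫ p : ℝ × ℝ, K (p.1 - p.2) * (stepOf T x p.1 * stepOf T y p.2)
        ∂((volume.restrict (Icc 0 (T : ℝ))).prod (volume.restrict (Icc 0 (T : ℝ)))) := by
  have hS := memLp_sumOf (T := T) (Z := fun a : Iic T => B a) fun a => hB a
  have hI := integrable_kernel_mul_stepOf hK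
  induction x using Finsupp.induction_linear with
  | zero => simp
  | add x x' hx hx' =>
    simp only [map_add, Pi.add_apply, add_mul, mul_add]
    rw [integral_add, integral_add, hx, hx']
    · exact hI _ _
    · exact hI _ _
    · exact (hS x).integrable_mul (hS y)
    · exact (hS x').integrable_mul (hS y)
  | single a c =>
    induction y using Finsupp.induction_linear with
    | zero => simp
    | add y y' hy hy' =>
      simp only [map_add, Pi.add_apply, mul_add]
      rw [integral_add, integral_add, hy, hy']
      · exact hI _ _
      · exact hI _ _
      · exact (hS _).integrable_mul (hS y)
      · exact (hS _).integrable_mul (hS y')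
    | single b d =>
      have hcov := covFun_eq_integral hB_zero hK_cov (t := (a : ℝ≥0)) (s := (b : ℝ≥0))
        ⟨by positivity, by exact_mod_cast a.2⟩ ⟨by positivity, by exact_mod_cast b.2⟩
      rw [integral_prod _ (hI _ _)]
      simp only [sumOf, stepOf, Finsupp.linearCombination_single, Pi.smul_apply, smul_eq_mul]
      have e1 : ∀ ω, c * B a ω * (d * B b ω) = (c * d) * (B a ω * B b ω) := fun ω => by ring
      have e2 : ∀ u w : ℝ, K (u - w) * (c * (Ioc (0 : ℝ) (a : ℝ≥0)).indicator 1 u *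
          (d * (Ioc (0 : ℝ) (b : ℝ≥0)).indicator 1 w)) = (c * d) *
          ((Ioc (0 : ℝ) (a : ℝ≥0)).indicator 1 u *
            (Ioc (0 : ℝ) (b : ℝ≥0)).indicator (fun w => K (u - w)) w) := fun u w => by
        simp only [indicator_apply, Pi.one_apply]
        split_ifs <;> ring
      have e3 : ∀ (u : ℝ) (g : ℝ), (Ioc (0 : ℝ) (a : ℝ≥0)).indicator 1 u * g =
          (Ioc (0 : ℝ) (a : ℝ≥0)).indicator (fun _ => g) u := fun u g => by
        simp only [indicator_apply, Pi.one_apply]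
        split_ifs <;> ring
      simp only [e1, e2, integral_const_mul]
      congr 1
      have hsub : ∀ b : Iic T, Ioc (0 : ℝ) (b : ℝ≥0) ⊆ Icc 0 (T : ℝ) := fun b =>
        Ioc_subset_Icc_self.trans (Icc_subset_Icc_right (by exact_mod_cast b.2))
      simp only [covFun, Real.toNNReal_coe] at hcov
      rw [hcov, ← inter_eq_self_of_subset_right (hsub a), ← setIntegral_indicator measurableSet_Ioc]
      refine integral_congr_ae (ae_of_all _ fun u => ?_)
      simp only [e3, setIntegral_indicator measurableSet_Ioc,
        inter_eq_self_of_subset_right (hsub b), inter_eq_self_of_subset_right (hsub a)]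
      simp only [indicator_apply]

lemma integral_sumOf_sq_le {Ω : Type*} [MeasurableSpace Ω] {P : Measure Ω} {B : ℝ≥0 → Ω → ℝ}
    {T : ℝ≥0} (hB : ∀ t, MemLp (B t) 2 P)
    (hB_zero : ∀ᵐ ω ∂P, B 0 ω = 0) {K : ℝ → ℝ} (hK_even : ∀ x, K (-x) = K x)
    (hK : IntegrableOn K (Icc (-(T : ℝ)) T))
    (hK_cov : HasMixedDeriv (covFun B P) (fun t s => K (t - s)) T) (x : Iic T →₀ ℝ) :
    ∫ ω, sumOf (fun a : Iic T => B a) x ω ^ 2 ∂P ≤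
      (∫ v in Icc (-(T : ℝ)) T, |K v|) * ∫ u in Icc 0 (T : ℝ), stepOf T x u ^ 2 := by
  simp only [sq (sumOf _ x _)]
  rw [integral_sumOf_mul_sumOf hB hB_zero hK hK_cov]
  exact integral_kernel_mul_mul_le hK_even hK (memLp_stepOf x)

/-! ### Density of step functions and existence of the integral -/

/-- Step functions of partitions and their Riemann sums are attached to one and the same family of
coefficients. -/
lemma exists_stepOf_eq_stepFun {Ω : Type*} (B : ℝ≥0 → Ω → ℝ) {T : ℝ≥0} {n : ℕ}
    {t : Fin (n + 1) → ℝ≥0} (ht : IsPartition T t) (c : Fin n → ℝ) :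
    ∃ x : Iic T →₀ ℝ, stepOf T x = stepFun t c ∧
      sumOf (fun a : Iic T => B a) x = riemannSum B t c := by
  have hle : ∀ k, t k ≤ T := fun k => by rw [← ht.2.2]; exact ht.1.monotone (Fin.le_last k)
  refine ⟨∑ k : Fin n, c k • (Finsupp.single ⟨t k.succ, hle _⟩ 1 -
    Finsupp.single ⟨t k.castSucc, hle _⟩ 1), ?_, ?_⟩
  · ext s
    simp only [stepOf, map_sum, map_smul, map_sub, Finsupp.linearCombination_single, one_smul,
      Finset.sum_apply, Pi.smul_apply, Pi.sub_apply, stepFun]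
    refine Finset.sum_congr rfl fun k _ => ?_
    have h1 : (t k.castSucc : ℝ) ≤ t k.succ := by
      exact_mod_cast ht.1.monotone (Fin.castSucc_lt_succ (i := k)).le
    have h0 : (0 : ℝ) ≤ t k.castSucc := NNReal.coe_nonneg _
    simp only [indicator_apply, mem_Ioc, Pi.one_apply, smul_eq_mul]
    split_ifs <;> first | (exfalso; grind) | simp
  · ext ω
    simp [sumOf, riemannSum, map_sum]

lemma stepFun_eq_of_mem {n : ℕ} {t : Fin (n + 1) → ℝ≥0} (ht : StrictMono t) (c : Fin n → ℝ)
    {k : Fin n} {s : ℝ} (hs : s ∈ Ioc (t k.castSucc : ℝ) (t k.succ : ℝ)) :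
    stepFun t c s = c k := by
  rw [stepFun, Finset.sum_eq_single k _ (by simp), indicator_of_mem hs]
  intro j _ hj
  refine indicator_of_notMem (fun hs' => ?_) _
  rcases lt_or_gt_of_ne hj with h | h
  · have : (t j.succ : ℝ) ≤ t k.castSucc := by exact_mod_cast ht.monotone (by simpa using h)
    linarith [hs'.2, hs.1]
  · have : (t k.succ : ℝ) ≤ t j.castSucc := by exact_mod_cast ht.monotone (by simpa using h)
    linarith [hs'.1, hs.2]

/-- A continuous function is uniformly approximated by step functions on `(0, T]`. -/
lemma exists_stepFun_abs_sub_le {T : ℝ≥0} (hT : 0 < T) {g : ℝ → ℝ} (hg : Continuous g)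
    {η : ℝ} (hη : 0 < η) :
    ∃ (n : ℕ) (t : Fin (n + 1) → ℝ≥0) (c : Fin n → ℝ), IsPartition T t ∧
      ∀ s ∈ Ioc 0 (T : ℝ), |g s - stepFun t c s| ≤ η := by
  have hT' : (0 : ℝ) < T := hT
  obtain ⟨d, hd, hgd⟩ := Metric.uniformContinuousOn_iff.1
    (isCompact_Icc.uniformContinuousOn_of_continuous (hg.continuousOn (s := Icc 0 (T : ℝ)))) η hη
  obtain ⟨n, hn⟩ := exists_nat_gt ((T : ℝ) / d)
  have hn0 : (0 : ℝ) < n := (by positivity : (0 : ℝ) ≤ T / d).trans_lt hn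
  have hn0' : 0 < n := by exact_mod_cast hn0
  have hstep : (T : ℝ) / n < d := by
    rw [div_lt_iff₀ hd] at hn
    rw [div_lt_iff₀ hn0]; linarith
  let t : Fin (n + 1) → ℝ≥0 := fun k => T * k / n
  have ht : IsPartition T t := by
    refine ⟨fun i j hij => ?_, by simp [t], ?_⟩
    · have : ((i : ℕ) : ℝ≥0) < (j : ℕ) := by exact_mod_cast hij
      have hn1 : (0 : ℝ≥0) < n := by exact_mod_cast hn0'
      simp only [t]
      gcongr
    · have hn1 : (n : ℝ≥0) ≠ 0 := by exact_mod_cast hn0'.ne'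
      simp [t, hn1]
  refine ⟨n, t, fun k => g (t k.succ), ht, fun s hs => ?_⟩
  -- `s` lies in the subinterval whose right end point is `T m / n`, where `m = ⌈s n / T⌉`.
  obtain ⟨m, hm⟩ : ∃ m, ⌈s * n / T⌉₊ = m + 1 :=
    Nat.exists_eq_succ_of_ne_zero (Nat.ceil_pos.2 (by have := hs.1; positivity)).ne'
  have hle : s * n / T ≤ (m : ℝ) + 1 := by exact_mod_cast hm ▸ Nat.le_ceil (s * n / T)
  have hlt : (m : ℝ) < s * n / T := Nat.lt_ceil.1 (by omega)
  have hmn : m < n := by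
    have : s * n / T ≤ n := by rw [div_le_iff₀ hT', mul_comm]; gcongr; exact hs.2
    exact_mod_cast hlt.trans_le this
  have hmem : s ∈ Ioc (t (Fin.castSucc ⟨m, hmn⟩) : ℝ) (t (Fin.succ ⟨m, hmn⟩) : ℝ) := by
    simp only [t, Fin.val_castSucc, Fin.val_succ, NNReal.coe_div, NNReal.coe_mul,
      NNReal.coe_natCast, Nat.cast_add, Nat.cast_one, mem_Ioc, NNReal.coe_add, NNReal.coe_one]
    rw [lt_div_iff₀ hT'] at hlt
    rw [div_le_iff₀ hT'] at hle
    rw [div_lt_iff₀ hn0, le_div_iff₀ hn0]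
    constructor <;> linarith
  rw [stepFun_eq_of_mem ht.1 _ hmem]
  refine (hgd s ⟨hs.1.le, hs.2⟩ _ ⟨NNReal.coe_nonneg _, ?_⟩ ?_).le
  · have hle : t (Fin.succ ⟨m, hmn⟩) ≤ T :=
      (ht.1.monotone (Fin.le_last _)).trans_eq ht.2.2
    exact_mod_cast hle
  · rw [dist_comm, Real.dist_eq, abs_of_nonneg (by linarith [hmem.2])]
    refine lt_of_le_of_lt ?_ hstep
    have h1 := hmem.1
    simp only [t, Fin.val_castSucc, Fin.val_succ, NNReal.coe_div, NNReal.coe_mul,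
      NNReal.coe_natCast, Nat.cast_add, Nat.cast_one, NNReal.coe_add, NNReal.coe_one] at h1 ⊢
    have : (T : ℝ) * (m + 1) / n = T * m / n + T / n := by ring
    linarith

lemma exists_stepFun_eLpNorm_sub_lt {T : ℝ≥0} (hT : 0 < T) {h : ℝ → ℝ}
    (hh : MemLp h 2 (volume.restrict (Icc 0 (T : ℝ)))) {δ : ℝ≥0∞} (hδ : 0 < δ) :
    ∃ (n : ℕ) (t : Fin (n + 1) → ℝ≥0) (c : Fin n → ℝ), IsPartition T t ∧
      eLpNorm (fun s => h s - stepFun t c s) 2 (volume.restrict (Icc 0 (T : ℝ))) < δ := by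
  set μ := volume.restrict (Icc 0 (T : ℝ)) with hμ
  obtain ⟨ε, hε0, hεδ⟩ := exists_between hδ
  have hε2 : ε / 2 ≠ 0 := (ENNReal.half_pos hε0.ne').ne'
  have hεtop : ε ≠ ⊤ := hεδ.ne_top
  obtain ⟨g, hg, hgm⟩ := hh.exists_boundedContinuous_eLpNorm_sub_le (by simp) hε2
  obtain ⟨η, hη, hηlt⟩ := ENNReal.exists_nnreal_pos_mul_lt (a := μ univ ^ (2 : ℝ≥0∞).toReal⁻¹)
    (b := ε / 2) (ENNReal.rpow_ne_top_of_nonneg (by positivity) (measure_ne_top _ _)) hε2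
  obtain ⟨n, t, c, ht, htc⟩ := exists_stepFun_abs_sub_le hT g.continuous (η := η) hη
  refine ⟨n, t, c, ht, lt_of_le_of_lt ?_ hεδ⟩
  have hm : AEStronglyMeasurable (stepFun t c) μ := by
    unfold stepFun
    exact (Finset.measurable_sum _ fun k _ =>
      measurable_const.indicator measurableSet_Ioc).aestronglyMeasurable
  have h2 : eLpNorm (⇑g - stepFun t c) 2 μ ≤ ε / 2 := by
    refine (eLpNorm_le_of_ae_bound (C := η) ?_).trans ?_
    · rw [hμ, ← Measure.restrict_congr_set Ioc_ae_eq_Icc]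
      filter_upwards [ae_restrict_mem measurableSet_Ioc] with s hs using htc s hs
    · rw [ENNReal.ofReal_coe_nnreal, mul_comm]
      exact hηlt.le
  calc eLpNorm (fun s => h s - stepFun t c s) 2 μ
      = eLpNorm ((h - ⇑g) + (⇑g - stepFun t c)) 2 μ := by
        congr 1; ext s; simp
    _ ≤ eLpNorm (h - ⇑g) 2 μ + eLpNorm (⇑g - stepFun t c) 2 μ :=
        eLpNorm_add_le (hh.sub hgm).1 (hgm.1.sub hm) (by norm_num)
    _ ≤ ε / 2 + ε / 2 := add_le_add hg h2
    _ = ε := ENNReal.add_halves ε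

lemma eLpNorm_two_eq_ofReal_sqrt {α : Type*} [MeasurableSpace α] {μ : Measure α} {f : α → ℝ}
    (hf : MemLp f 2 μ) : eLpNorm f 2 μ = ENNReal.ofReal √(∫ a, f a ^ 2 ∂μ) := by
  rw [hf.eLpNorm_eq_integral_rpow_norm (by simp) (by simp), Real.sqrt_eq_rpow]
  simp

/-- The passage from step functions to the corresponding sums is bounded from `L²[0, T]` to
`L²(P)`. -/
lemma exists_eLpNorm_sumOf_le {Ω : Type*} [MeasurableSpace Ω] {P : Measure Ω} {B : ℝ≥0 → Ω → ℝ}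
    {T : ℝ≥0} (hB : ∀ t, MemLp (B t) 2 P)
    (hB_zero : ∀ᵐ ω ∂P, B 0 ω = 0) {K : ℝ → ℝ} (hK_even : ∀ x, K (-x) = K x)
    (hK : IntegrableOn K (Icc (-(T : ℝ)) T))
    (hK_cov : HasMixedDeriv (covFun B P) (fun t s => K (t - s)) T) :
    ∃ c : ℝ≥0, 0 < c ∧ ∀ x : Iic T →₀ ℝ, eLpNorm (sumOf (fun a : Iic T => B a) x) 2 P ≤
      c * eLpNorm (stepOf T x) 2 (volume.restrict (Icc 0 (T : ℝ))) := by
  set C := ∫ v in Icc (-(T : ℝ)) T, |K v|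
  have hC : 0 ≤ C := integral_nonneg fun v => abs_nonneg _
  refine ⟨(√C + 1).toNNReal, Real.toNNReal_pos.2 (by positivity), fun x => ?_⟩
  rw [eLpNorm_two_eq_ofReal_sqrt (memLp_sumOf (fun a : Iic T => hB a) x),
    eLpNorm_two_eq_ofReal_sqrt (memLp_stepOf x), ← ENNReal.ofReal,
    ← ENNReal.ofReal_mul (by positivity)]
  refine ENNReal.ofReal_le_ofReal ?_
  refine (Real.sqrt_le_sqrt
    (integral_sumOf_sq_le hB hB_zero hK_even hK hK_cov x)).trans ?_
  rw [Real.sqrt_mul hC]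
  gcongr
  linarith

/-- Step functions converging to `h` in `L²[0, T]` give sums that are Cauchy in `L²(P)`; their limit
is the integral. -/
lemma exists_isIntegral {Ω : Type*} [MeasurableSpace Ω] {P : Measure Ω} {B : ℝ≥0 → Ω → ℝ}
    {T : ℝ≥0} (hT : 0 < T) (hB : ∀ t, MemLp (B t) 2 P)
    {c : ℝ≥0} (hc : 0 < c) (hbound : ∀ x : Iic T →₀ ℝ,
      eLpNorm (sumOf (fun a : Iic T => B a) x) 2 P ≤
        c * eLpNorm (stepOf T x) 2 (volume.restrict (Icc 0 (T : ℝ))))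
    {h : ℝ → ℝ} (hh : MemLp h 2 (volume.restrict (Icc 0 (T : ℝ)))) :
    ∃ J : Ω → ℝ, IsIntegral B P T h J := by
  set μ := volume.restrict (Icc 0 (T : ℝ)) with hμ
  set S := sumOf (fun a : Iic T => B a)
  have hS : ∀ x, MemLp (S x) 2 P := memLp_sumOf (fun a : Iic T => hB a)
  have hc0 : (c : ℝ≥0∞) ≠ 0 := by exact_mod_cast hc.ne'
  -- The distance of two sums is controlled by the distances of the step functions to `h`
  have hdist : ∀ x y : Iic T →₀ ℝ, ∀ a b : ℝ≥0∞, eLpNorm (h - stepOf T x) 2 μ < a →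
      eLpNorm (h - stepOf T y) 2 μ < b → eLpNorm (S x - S y) 2 P < c * (a + b) := by
    intro x y a b hx hy
    rw [← map_sub]
    refine (hbound _).trans_lt (ENNReal.mul_lt_mul_right hc0 ENNReal.coe_ne_top ?_)
    refine lt_of_le_of_lt ?_ (ENNReal.add_lt_add hx hy)
    have : stepOf T (x - y) = (stepOf T x - h) + (h - stepOf T y) := by rw [map_sub]; abel
    rw [this, eLpNorm_sub_comm h (stepOf T x)]
    exact eLpNorm_add_le ((memLp_stepOf x).sub hh).1 (hh.sub (memLp_stepOf y)).1 (by norm_num)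
  have hpos : ∀ N : ℕ, (0 : ℝ≥0∞) < 2⁻¹ ^ N / (2 * c) := fun N =>
    ENNReal.div_pos (ENNReal.pow_pos (by simp) N).ne' (by finiteness)
  have hex : ∀ N : ℕ, ∃ x : Iic T →₀ ℝ, eLpNorm (h - stepOf T x) 2 μ < 2⁻¹ ^ N / (2 * c) := by
    intro N
    obtain ⟨n, t, d, ht, htd⟩ := exists_stepFun_eLpNorm_sub_lt hT hh (hpos N)
    obtain ⟨x, hx, -⟩ := exists_stepOf_eq_stepFun B ht d
    exact ⟨x, by rw [hx]; exact htd⟩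
  choose x hx using hex
  have hcancel : ∀ a : ℝ≥0∞, (c : ℝ≥0∞) * (a / (2 * c) + a / (2 * c)) = a := fun a => by
    rw [← ENNReal.add_div, ← two_mul, ENNReal.mul_div_mul_left _ _ (by simp) (by simp),
      ENNReal.mul_div_cancel hc0 ENNReal.coe_ne_top]
  have hanti : ∀ N n : ℕ, N ≤ n →
      (2⁻¹ : ℝ≥0∞) ^ n / (2 * c) ≤ 2⁻¹ ^ N / (2 * c) := fun N n hn => by
    gcongr ?_ / _
    exact pow_le_pow_right_of_le_one' (by simp) hn
  obtain ⟨J, hJ, hJlim⟩ := Lp.cauchy_complete_eLpNorm (p := 2) (by norm_num)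
    (fun n => hS (x n)) (B := fun N => 2⁻¹ ^ N) (by rw [ENNReal.tsum_geometric]; simp)
    (fun N n m hn hm => by
      have := hdist (x n) (x m) _ _ ((hx n).trans_le (hanti N n hn))
        ((hx m).trans_le (hanti N m hm))
      rwa [hcancel] at this)
  refine ⟨J, hJ, fun ε hε => ?_⟩
  obtain ⟨ε', hε', hεε'⟩ := exists_between hε
  have hε2 : 0 < ε' / 2 := ENNReal.half_pos hε'.ne'
  have hδ : 0 < ε' / 2 / (2 * c) := ENNReal.div_pos hε2.ne' (by finiteness)
  refine ⟨ε' / 2 / (2 * c), hδ, fun n t d ht htd => ?_⟩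
  obtain ⟨y, hy, hy'⟩ := exists_stepOf_eq_stepFun B ht d
  have hgeom : Filter.Tendsto (fun N : ℕ => (2⁻¹ : ℝ≥0∞) ^ N) Filter.atTop (nhds 0) :=
    ENNReal.tendsto_pow_atTop_nhds_zero_of_lt_one (by simp)
  obtain ⟨N, hN1, hN2⟩ := ((hJlim.eventually (gt_mem_nhds hε2)).and
    (hgeom.eventually (gt_mem_nhds hε2))).exists
  have hd := hdist (x N) y _ _ ((hx N).trans_le (ENNReal.div_le_div_right hN2.le _))
    (by rw [hy]; exact htd)
  rw [hcancel] at hd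
  calc eLpNorm (fun ω => J ω - riemannSum B t d ω) 2 P
      = eLpNorm ((J - S (x N)) + (S (x N) - S y)) 2 P := by
        congr 1; ext ω; simp only [← hy', S, Pi.add_apply, Pi.sub_apply]; ring
    _ ≤ eLpNorm (J - S (x N)) 2 P + eLpNorm (S (x N) - S y) 2 P :=
        eLpNorm_add_le (hJ.sub (hS _)).1 ((hS _).sub (hS _)).1 (by norm_num)
    _ ≤ ε' / 2 + ε' / 2 := by
        rw [eLpNorm_sub_comm]; exact add_le_add hN1.le hd.le
    _ = ε' := ENNReal.add_halves ε'
    _ < ε := hεε'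

/-- A mean square integral is approximated by sums along step functions converging to the
integrand. -/
lemma IsIntegral.exists_seq {Ω : Type*} [MeasurableSpace Ω] {P : Measure Ω} {B : ℝ≥0 → Ω → ℝ}
    {T : ℝ≥0} (hT : 0 < T) {h : ℝ → ℝ} (hh : MemLp h 2 (volume.restrict (Icc 0 (T : ℝ))))
    {J : Ω → ℝ} (hJ : IsIntegral B P T h J) :
    ∃ x : ℕ → Iic T →₀ ℝ,
      Filter.Tendsto (fun n => eLpNorm (stepOf T (x n) - h) 2 (volume.restrict (Icc 0 (T : ℝ))))
        Filter.atTop (nhds 0) ∧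
      Filter.Tendsto (fun n => eLpNorm (sumOf (fun a : Iic T => B a) (x n) - J) 2 P)
        Filter.atTop (nhds 0) := by
  have hex : ∀ N : ℕ, ∃ x : Iic T →₀ ℝ,
      eLpNorm (stepOf T x - h) 2 (volume.restrict (Icc 0 (T : ℝ))) ≤ ((N : ℝ≥0∞) + 1)⁻¹ ∧
      eLpNorm (sumOf (fun a : Iic T => B a) x - J) 2 P ≤ ((N : ℝ≥0∞) + 1)⁻¹ := by
    intro N
    have hN : (0 : ℝ≥0∞) < ((N : ℝ≥0∞) + 1)⁻¹ := ENNReal.inv_pos.2 (by finiteness)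
    obtain ⟨δ, hδ, hJδ⟩ := hJ.2 _ hN
    obtain ⟨n, t, d, ht, htd⟩ := exists_stepFun_eLpNorm_sub_lt hT hh (lt_min hδ hN)
    obtain ⟨y, hy, hy'⟩ := exists_stepOf_eq_stepFun B ht d
    refine ⟨y, ?_, ?_⟩
    · rw [eLpNorm_sub_comm, hy]
      exact (htd.trans_le (min_le_right _ _)).le
    · rw [eLpNorm_sub_comm, hy']
      exact (hJδ n t d ht (htd.trans_le (min_le_left _ _))).le
  choose x hx hx' using hex
  have hlim : Filter.Tendsto (fun N : ℕ => ((N : ℝ≥0∞) + 1)⁻¹) Filter.atTop (nhds 0) := by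
    simpa using (Filter.tendsto_add_atTop_iff_nat 1).2 ENNReal.tendsto_inv_nat_nhds_zero
  exact ⟨x, tendsto_of_tendsto_of_tendsto_of_le_of_le tendsto_const_nhds hlim
    (fun _ => zero_le) hx, tendsto_of_tendsto_of_tendsto_of_le_of_le tendsto_const_nhds hlim
    (fun _ => zero_le) hx'⟩

/-! ### Mean square limits -/

/-- Continuity of the inner product of `L²`, for functions rather than classes. -/
lemma tendsto_integral_mul {α : Type*} [MeasurableSpace α] {μ : Measure α} {f : ℕ → α → ℝ}
    {g : ℕ → α → ℝ} {f' g' : α → ℝ}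
    (hf : ∀ n, MemLp (f n) 2 μ) (hf' : MemLp f' 2 μ) (hg : ∀ n, MemLp (g n) 2 μ)
    (hg' : MemLp g' 2 μ)
    (hlim : Filter.Tendsto (fun n => eLpNorm (f n - f') 2 μ) Filter.atTop (nhds 0))
    (hlim' : Filter.Tendsto (fun n => eLpNorm (g n - g') 2 μ) Filter.atTop (nhds 0)) :
    Filter.Tendsto (fun n => ∫ a, f n a * g n a ∂μ) Filter.atTop (nhds (∫ a, f' a * g' a ∂μ)) := by
  have hinner : ∀ {u v : α → ℝ} (hu : MemLp u 2 μ) (hv : MemLp v 2 μ),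
      inner ℝ (hv.toLp v) (hu.toLp u) = ∫ a, u a * v a ∂μ := fun {u v} hu hv => by
    rw [L2.inner_def]
    refine integral_congr_ae ?_
    filter_upwards [hu.coeFn_toLp, hv.coeFn_toLp] with a h1 h2
    rw [h1, h2]
    simp
  have h1 := (Lp.tendsto_Lp_iff_tendsto_eLpNorm'' f hf f' hf').2 hlim
  have h2 := (Lp.tendsto_Lp_iff_tendsto_eLpNorm'' g hg g' hg').2 hlim'
  simpa only [hinner] using h2.inner (𝕜 := ℝ) h1

/-- A mean square limit of Gaussian random variables is Gaussian: the characteristic functions,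
the means and the variances converge. -/
lemma hasGaussianLaw_of_tendsto {Ω : Type*} [MeasurableSpace Ω] {P : Measure Ω}
    [IsProbabilityMeasure P] {V : ℕ → Ω → ℝ} {V' : Ω → ℝ} (hV : ∀ n, HasGaussianLaw (V n) P)
    (hV' : MemLp V' 2 P)
    (hlim : Filter.Tendsto (fun n => eLpNorm (V n - V') 2 P) Filter.atTop (nhds 0)) :
    HasGaussianLaw V' P := by
  have hL : ∀ n, MemLp (V n) 2 P := fun n => (hV n).memLp_two
  obtain ⟨φ, hφ, hae⟩ := (tendstoInMeasure_of_tendsto_eLpNorm (by norm_num)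
    (fun n => (hL n).1) hV'.1 hlim).exists_seq_tendsto_ae
  have hmean : Filter.Tendsto (fun n => ∫ ω, V n ω ∂P) Filter.atTop (nhds (∫ ω, V' ω ∂P)) := by
    simpa using tendsto_integral_mul hL hV' (fun _ => memLp_const (1 : ℝ)) (memLp_const (1 : ℝ))
      hlim (by simp)
  have hsq := tendsto_integral_mul hL hV' hL hV' hlim hlim
  have hvar : Filter.Tendsto (fun n => Var[V n; P]) Filter.atTop (nhds Var[V'; P]) := by
    simp only [variance_eq_sub (hL _), variance_eq_sub hV', Pi.pow_apply]
    simp only [sq] at hsq ⊢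
    exact hsq.sub (hmean.mul hmean)
  rw [hasGaussianLaw_iff_charFun_map_eq hV'.1.aemeasurable]
  intro t
  have hchar : ∀ {U : Ω → ℝ}, AEMeasurable U P →
      charFun (P.map U) t = ∫ ω, Complex.exp (t * U ω * Complex.I) ∂P := fun {U} hU => by
    rw [charFun_apply_real, integral_map hU (by fun_prop)]
  have hl1 : Filter.Tendsto (fun n => charFun (P.map (V (φ n))) t) Filter.atTop
      (nhds (charFun (P.map V') t)) := by
    simp only [hchar (hL _).1.aemeasurable, hchar hV'.1.aemeasurable]
    refine tendsto_integral_of_dominated_convergence (fun _ => 1) (fun n => ?_)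
      (integrable_const _) (fun n => ae_of_all _ fun ω => ?_) ?_
    · have := (hL (φ n)).1.aemeasurable
      exact AEMeasurable.aestronglyMeasurable (by fun_prop)
    · rw [← Complex.ofReal_mul, Complex.norm_exp_ofReal_mul_I]
    · filter_upwards [hae] with ω hω
      have hc : Continuous fun y : ℝ => Complex.exp (t * y * Complex.I) := by fun_prop
      exact (hc.tendsto _).comp hω
  refine tendsto_nhds_unique hl1 ?_
  have hcomm : ∀ U : Ω → ℝ, (fun ω => inner ℝ t (U ω)) = fun ω => t * U ω := fun U => by
    ext ω; simp [mul_comm]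
  simp only [(hV _).charFun_map_eq, hcomm, integral_const_mul, variance_const_mul]
  have hm := hmean.comp hφ.tendsto_atTop
  have hv := hvar.comp hφ.tendsto_atTop
  have hc : Continuous fun q : ℝ × ℝ =>
      Complex.exp (((t * q.1 : ℝ) : ℂ) * Complex.I - ((t ^ 2 * q.2 : ℝ) : ℂ) / 2) := by fun_prop
  exact (hc.tendsto _).comp (hm.prodMk_nhds hv)

/-- A pointwise mean square limit of Gaussian processes is a Gaussian process. -/
lemma isGaussianProcess_of_tendsto {Ω S : Type*} [MeasurableSpace Ω] {P : Measure Ω}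
    [IsProbabilityMeasure P] {X : ℕ → S → Ω → ℝ} {Y : S → Ω → ℝ}
    (hX : ∀ n, IsGaussianProcess (X n) P) (hY : ∀ s, MemLp (Y s) 2 P)
    (hlim : ∀ s, Filter.Tendsto (fun n => eLpNorm (X n s - Y s) 2 P) Filter.atTop (nhds 0)) :
    IsGaussianProcess Y P where
  hasGaussianLaw I := by
    have hmeas : AEMeasurable (fun ω => I.restrict (Y · ω)) P :=
      aemeasurable_pi_lambda _ fun i => (hY i).1.aemeasurable
    refine ⟨⟨fun L => ?_⟩⟩
    obtain ⟨c, hc⟩ : ∃ c : I → ℝ, ∀ v : I → ℝ, L v = ∑ i, c i * v i := by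
      classical
      refine ⟨fun i => L (Pi.single i 1), fun v => ?_⟩
      conv_lhs => rw [pi_eq_sum_univ' v, map_sum]
      refine Finset.sum_congr rfl fun i _ => ?_
      rw [map_smul, smul_eq_mul, mul_comm]
    have hexp : ∀ Z : S → Ω → ℝ, (L ∘ fun ω => I.restrict (Z · ω)) =
        ∑ i : I, c i • Z i := fun Z => by
      ext ω
      simp [hc]
    have hm : MemLp (∑ i : I, c i • Y i) 2 P :=
      memLp_finsetSum' _ fun i _ => (hY i).const_smul _
    have hG : HasGaussianLaw (L ∘ fun ω => I.restrict (Y · ω)) P := by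
      rw [hexp]
      refine hasGaussianLaw_of_tendsto (V := fun n => L ∘ fun ω => I.restrict (X n · ω))
        (fun n => ((hX n).hasGaussianLaw I).map L) hm ?_
      simp only [hexp]
      have hXm : ∀ n s, MemLp (X n s) 2 P := fun n s => ((hX n).hasGaussianLaw_eval s).memLp_two
      have h0 : Filter.Tendsto (fun n => ∑ i : I, ‖c i‖ₑ *
          eLpNorm (X n i - Y i) 2 P) Filter.atTop (nhds 0) := by
        simpa using tendsto_finsetSum (Finset.univ : Finset I) fun i _ =>
          ENNReal.Tendsto.const_mul (a := ‖c i‖ₑ) (hlim i) (.inr enorm_ne_top)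
      refine tendsto_of_tendsto_of_tendsto_of_le_of_le tendsto_const_nhds h0
        (fun _ => zero_le) fun n => ?_
      simp only [← Finset.sum_sub_distrib, ← smul_sub]
      have hsum := eLpNorm_sum_le (s := (Finset.univ : Finset I)) (p := 2) (μ := P)
        (f := fun i => c i • (X n i - Y i))
        (fun i _ => (((hXm n i).sub (hY i)).const_smul (c i)).1) (by norm_num)
      simpa only [eLpNorm_const_smul] using hsum
    have hLm : Measurable L := L.continuous.measurable
    rw [AEMeasurable.map_map_of_aemeasurable hLm.aemeasurable hmeas, hG.map_eq_gaussianReal,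
      integral_map hmeas hLm.aestronglyMeasurable, variance_map hLm.aemeasurable hmeas]
    rfl

/-! ### The covariances of the integral -/

lemma stepOf_single {T : ℝ≥0} (a : Iic T) (u : ℝ) :
    stepOf T (Finsupp.single a 1) u = (Ioc (0 : ℝ) (a : ℝ≥0)).indicator 1 u := by
  simp [stepOf]

lemma sumOf_single {Ω : Type*} {T : ℝ≥0} (Z : Iic T → Ω → ℝ) (a : Iic T) :
    sumOf Z (Finsupp.single a 1) = Z a := by
  simp [sumOf]

lemma Ioc_subset_Icc_of_Iic {T : ℝ≥0} (a : Iic T) :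
    Ioc (0 : ℝ) (a : ℝ≥0) ⊆ Icc 0 (T : ℝ) :=
  Ioc_subset_Icc_self.trans (Icc_subset_Icc_right (by exact_mod_cast a.2))

/-- The equation `Γ h = 1` says that the integral of `h` has covariance `a` with the value of the
process at time `a`. -/
lemma integral_mul_isIntegral {Ω : Type*} [MeasurableSpace Ω] {P : Measure Ω} {B : ℝ≥0 → Ω → ℝ}
    {T : ℝ≥0} (hT : 0 < T) (hB : ∀ t, MemLp (B t) 2 P)
    (hB_zero : ∀ᵐ ω ∂P, B 0 ω = 0) {K : ℝ → ℝ}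
    (hK : IntegrableOn K (Icc (-(T : ℝ)) T))
    (hK_cov : HasMixedDeriv (covFun B P) (fun t s => K (t - s)) T) {h : ℝ → ℝ}
    (hh : MemLp h 2 (volume.restrict (Icc 0 (T : ℝ))))
    (hh_eq : ∀ᵐ t ∂(volume.restrict (Icc 0 (T : ℝ))), gammaOp K (T : ℝ) h t = 1)
    {J : Ω → ℝ} (hJ : IsIntegral B P T h J) (a : Iic T) :
    ∫ ω, B a ω * J ω ∂P = (a : ℝ≥0) := by
  obtain ⟨x, hx, hx'⟩ := hJ.exists_seq hT hh
  set μ := volume.restrict (Icc 0 (T : ℝ)) with hμ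
  set e := stepOf T (Finsupp.single a 1) with he
  -- `G` represents the functional `f ↦ E[B a * ∫ f dB]`; it is bounded, hence in `L²[0, T]`.
  set G : ℝ → ℝ := fun w => ∫ u, K (u - w) * e u ∂μ with hG
  have hbd : ∀ u, |e u| ≤ 1 := fun u => by
    rw [he, stepOf_single]
    simp only [indicator_apply, Pi.one_apply]
    split_ifs <;> simp
  have hem : AEStronglyMeasurable (fun p : ℝ × ℝ => e p.1) (μ.prod μ) :=
    ((measurable_stepOf _).comp measurable_fst).aestronglyMeasurable
  have hint : ∀ {F : ℝ → ℝ}, Integrable F μ →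
      Integrable (fun p : ℝ × ℝ => F p.2 * (K (p.1 - p.2) * e p.1)) (μ.prod μ) := fun {F} hF =>
    ((integrable_mul_kernel hK hF).bdd_mul (c := 1) hem (ae_of_all _ fun p => hbd p.1)).congr
      (ae_of_all _ fun p => by ring)
  have hG_mem : MemLp G 2 μ := by
    have h1 := hint (F := fun _ => 1) (integrable_const _)
    simp only [one_mul] at h1
    refine .of_bound h1.integral_prod_right.1 (∫ v in Icc (-(T : ℝ)) T, |K v|) ?_
    have h2 := (integrable_mul_kernel hK (F := fun _ => 1) (integrable_const _)).abs.prod_left_ae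
    filter_upwards [ae_restrict_mem measurableSet_Icc, h2] with w hw h2
    simp only [one_mul] at h2
    refine (norm_integral_le_of_norm_le h2 (ae_of_all _ fun u => ?_)).trans
      (integral_abs_kernel_le hK hw)
    rw [Real.norm_eq_abs, abs_mul]
    exact mul_le_of_le_one_right (abs_nonneg _) (hbd u)
  have hFub : ∀ {F : ℝ → ℝ}, Integrable F μ →
      ∫ w, F w * G w ∂μ = ∫ u, e u * (∫ w, K (u - w) * F w ∂μ) ∂μ := fun {F} hF => by
    have := hint hF
    simp only [hG, ← integral_const_mul]
    rw [← integral_prod_symm _ this, integral_prod _ this]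
    refine integral_congr_ae (ae_of_all _ fun u => integral_congr_ae (ae_of_all _ fun w => ?_))
    ring
  have hstep : ∀ y : Iic T →₀ ℝ, ∫ ω, B a ω * sumOf (fun a : Iic T => B a) y ω ∂P =
      ∫ w, G w * stepOf T y w ∂μ := fun y => by
    have := integral_sumOf_mul_sumOf hB hB_zero hK hK_cov (Finsupp.single a 1) y
    rw [sumOf_single] at this
    rw [this, integral_prod_symm _ (integrable_kernel_mul_stepOf hK _ _)]
    refine integral_congr_ae (ae_of_all _ fun w => ?_)
    simp only [hG, ← integral_mul_const]
    refine integral_congr_ae (ae_of_all _ fun u => ?_)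
    simp only [he]
    ring
  have hl1 := tendsto_integral_mul (fun _ : ℕ => hB a) (hB a)
    (fun n => memLp_sumOf (fun a : Iic T => hB a) (x n)) hJ.1 (by simp) hx'
  have hl2 := tendsto_integral_mul (fun _ : ℕ => hG_mem) hG_mem
    (fun n => memLp_stepOf (x n)) hh (by simp) hx
  simp only [hstep] at hl1
  rw [tendsto_nhds_unique hl1 hl2]
  simp only [mul_comm (G _)]
  rw [hFub (hh.integrable (by norm_num))]
  calc ∫ u, e u * (∫ w, K (u - w) * h w ∂μ) ∂μ = ∫ u, e u ∂μ := by
        refine integral_congr_ae ?_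
        filter_upwards [hh_eq] with u hu
        rw [gammaOp] at hu
        rw [hu, mul_one]
    _ = (a : ℝ≥0) := by
        simp only [he, stepOf_single, hμ]
        rw [setIntegral_indicator measurableSet_Ioc,
          inter_eq_self_of_subset_right (Ioc_subset_Icc_of_Iic a)]
        simp

lemma integral_sumOf_mul_isIntegral {Ω : Type*} [MeasurableSpace Ω] {P : Measure Ω}
    {B : ℝ≥0 → Ω → ℝ} {T : ℝ≥0} (hB : ∀ t, MemLp (B t) 2 P) {J : Ω → ℝ} (hJ : MemLp J 2 P)
    (hBJ : ∀ a : Iic T, ∫ ω, B a ω * J ω ∂P = (a : ℝ≥0)) (x : Iic T →₀ ℝ) :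
    ∫ ω, sumOf (fun a : Iic T => B a) x ω * J ω ∂P =
      ∫ u in Icc 0 (T : ℝ), stepOf T x u := by
  have hS := memLp_sumOf (T := T) (Z := fun a : Iic T => B a) fun a => hB a
  have hI : ∀ y, Integrable (stepOf T y) (volume.restrict (Icc 0 (T : ℝ))) := fun y =>
    memLp_one_iff_integrable.1 (memLp_stepOf y)
  induction x using Finsupp.induction_linear with
  | zero => simp
  | add x y hx hy =>
    simp only [map_add, Pi.add_apply, add_mul]
    rw [integral_add, integral_add (hI x) (hI y), hx, hy]
    · exact (hS x).integrable_mul hJ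
    · exact (hS y).integrable_mul hJ
  | single a c =>
    simp only [sumOf, stepOf, Finsupp.linearCombination_single, Pi.smul_apply, smul_eq_mul,
      mul_assoc, integral_const_mul]
    rw [hBJ, setIntegral_indicator measurableSet_Ioc,
      inter_eq_self_of_subset_right (Ioc_subset_Icc_of_Iic a)]
    simp

/-- The variance of the integral of a solution `h` of `Γ h = 1` is `∫ h`. -/
lemma integral_isIntegral_mul_self {Ω : Type*} [MeasurableSpace Ω] {P : Measure Ω}
    {B : ℝ≥0 → Ω → ℝ} {T : ℝ≥0} (hT : 0 < T) (hB : ∀ t, MemLp (B t) 2 P) {h : ℝ → ℝ}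
    (hh : MemLp h 2 (volume.restrict (Icc 0 (T : ℝ)))) {J : Ω → ℝ} (hJ : IsIntegral B P T h J)
    (hBJ : ∀ a : Iic T, ∫ ω, B a ω * J ω ∂P = (a : ℝ≥0)) :
    ∫ ω, J ω * J ω ∂P = ∫ u in Icc 0 (T : ℝ), h u := by
  obtain ⟨x, hx, hx'⟩ := hJ.exists_seq hT hh
  have hl1 := tendsto_integral_mul (fun n => memLp_sumOf (fun a : Iic T => hB a) (x n)) hJ.1
    (fun _ : ℕ => hJ.1) hJ.1 hx' (by simp)
  have hl2 := tendsto_integral_mul (fun n => memLp_stepOf (x n)) hh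
    (fun _ : ℕ => memLp_const (1 : ℝ)) (memLp_const (1 : ℝ)) hx (by simp)
  simp only [integral_sumOf_mul_isIntegral hB hJ.1 hBJ] at hl1
  simp only [mul_one] at hl2
  exact tendsto_nhds_unique hl1 hl2

lemma integral_isIntegral {Ω : Type*} [MeasurableSpace Ω] {P : Measure Ω} [IsProbabilityMeasure P]
    {B : ℝ≥0 → Ω → ℝ} {T : ℝ≥0} (hT : 0 < T) (hB : ∀ t, MemLp (B t) 2 P)
    (hB_centered : ∀ t, ∫ ω, B t ω ∂P = 0) {h : ℝ → ℝ}
    (hh : MemLp h 2 (volume.restrict (Icc 0 (T : ℝ)))) {J : Ω → ℝ}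
    (hJ : IsIntegral B P T h J) : ∫ ω, J ω ∂P = 0 := by
  obtain ⟨x, -, hx'⟩ := hJ.exists_seq hT hh
  have hS := memLp_sumOf (T := T) (Z := fun a : Iic T => B a) fun a => hB a
  have h0 : ∀ y : Iic T →₀ ℝ, ∫ ω, sumOf (fun a : Iic T => B a) y ω ∂P = 0 := fun y => by
    induction y using Finsupp.induction_linear with
    | zero => simp
    | add y z hy hz =>
      simp only [map_add, Pi.add_apply]
      rw [integral_add ((hS y).integrable (by norm_num)) ((hS z).integrable (by norm_num)), hy, hz,
        add_zero]
    | single a c =>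
      simp [sumOf, integral_const_mul, hB_centered]
  have hl := tendsto_integral_mul (fun n => hS (x n)) hJ.1
    (fun _ : ℕ => memLp_const (1 : ℝ)) (memLp_const (1 : ℝ)) hx' (by simp)
  simp only [mul_one, h0] at hl
  exact (tendsto_nhds_unique tendsto_const_nhds hl).symm

/-! ### The integral as a functional of the path -/

lemma measurable_sumOf {Ω : Type*} [MeasurableSpace Ω] {T : ℝ≥0} {Z : Iic T → Ω → ℝ}
    (hZ : ∀ a, Measurable (Z a)) (x : Iic T →₀ ℝ) : Measurable (sumOf Z x) := by
  induction x using Finsupp.induction_linear with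
  | zero => simpa using measurable_zero
  | add x y hx hy => rw [map_add]; exact hx.add hy
  | single a c => rw [sumOf, Finsupp.linearCombination_single]; exact (hZ a).const_smul c

lemma measurable_pathX {Ω : Type*} [MeasurableSpace Ω] {B : ℝ≥0 → Ω → ℝ}
    (hB : ∀ t, Measurable (B t)) (T : ℝ≥0) (θ : ℝ) : Measurable (pathX B T θ) :=
  measurable_pi_lambda _ fun a => (hB a).const_add (θ * ((a : ℝ≥0) : ℝ))

lemma sumOf_eval_pathX {Ω : Type*} (B : ℝ≥0 → Ω → ℝ) {T : ℝ≥0} (x : Iic T →₀ ℝ) (ω : Ω) :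
    sumOf (fun (a : Iic T) (p : Iic T → ℝ) => p a) x (pathX B T 0 ω) =
      sumOf (fun a : Iic T => B a) x ω := by
  simp [sumOf, pathX, Finsupp.linearCombination_apply, Finsupp.sum]

/-- The mean square integral is almost surely a limit of finite linear combinations of the values
of the path, hence a measurable functional of the path. -/
lemma IsIntegral.exists_functional {Ω : Type*} [MeasurableSpace Ω] {P : Measure Ω}
    [IsProbabilityMeasure P] {B : ℝ≥0 → Ω → ℝ} {T : ℝ≥0} (hT : 0 < T)
    (hB_meas : ∀ t, Measurable (B t)) {h : ℝ → ℝ}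
    (hh : MemLp h 2 (volume.restrict (Icc 0 (T : ℝ)))) {J : Ω → ℝ} (hJ : IsIntegral B P T h J) :
    ∃ Φ : (Iic T → ℝ) → ℝ, Measurable Φ ∧ ∀ᵐ ω ∂P, Φ (pathX B T 0 ω) = J ω := by
  obtain ⟨x, -, hx⟩ := hJ.exists_seq hT hh
  obtain ⟨φ, -, hae⟩ := (tendstoInMeasure_of_tendsto_eLpNorm (by norm_num)
    (fun n => (measurable_sumOf (fun a : Iic T => hB_meas a) (x n)).aestronglyMeasurable)
    hJ.1.1 hx).exists_seq_tendsto_ae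
  have hm : ∀ n, Measurable (sumOf (fun (a : Iic T) (p : Iic T → ℝ) => p a) (x (φ n))) :=
    fun n => measurable_sumOf (fun a => measurable_pi_apply a) _
  have hp := measurable_pathX hB_meas T 0
  obtain ⟨Φ, hΦ, hlim⟩ := measurable_limit_of_tendsto_metrizable_ae (μ := P.map (pathX B T 0))
    (L := Filter.atTop) (fun n => (hm n).aemeasurable) (by
      rw [ae_map_iff hp.aemeasurable (measurableSet_exists_tendsto hm)]
      filter_upwards [hae] with ω hω
      exact ⟨J ω, by simpa only [sumOf_eval_pathX] using hω⟩)
  refine ⟨Φ, hΦ, ?_⟩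
  filter_upwards [hae, ae_of_ae_map hp.aemeasurable hlim] with ω h1 h2
  simp only [sumOf_eval_pathX] at h2
  exact tendsto_nhds_unique h2 h1

lemma IsIntegral.congr {Ω : Type*} [MeasurableSpace Ω] {P : Measure Ω} {B : ℝ≥0 → Ω → ℝ}
    {T : ℝ≥0} {h : ℝ → ℝ} {J J' : Ω → ℝ} (hJ : IsIntegral B P T h J) (hJJ' : J =ᵐ[P] J') :
    IsIntegral B P T h J' := by
  refine ⟨hJ.1.ae_eq hJJ', fun ε hε => ?_⟩
  obtain ⟨δ, hδ, H⟩ := hJ.2 ε hε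
  refine ⟨δ, hδ, fun n t c ht htc => ?_⟩
  rw [eLpNorm_congr_ae (g := fun ω => J ω - riemannSum B t c ω)]
  · exact H n t c ht htc
  · filter_upwards [hJJ'] with ω hω
    rw [hω]

/-! ### Orthogonal decomposition of the process along the integral -/

/-- Finite linear combinations of the values of a Gaussian process form a Gaussian process. -/
lemma isGaussianProcess_sumOf {Ω S : Type*} [MeasurableSpace Ω] {P : Measure Ω} {T : ℝ≥0}
    {Z : Iic T → Ω → ℝ} (hZ : IsGaussianProcess Z P) (y : S → Iic T →₀ ℝ) :
    IsGaussianProcess (fun s => sumOf Z (y s)) P := by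
  refine hZ.of_isGaussianProcess fun s => ⟨(y s).support,
    ∑ i : (y s).support, (y s i) • ContinuousLinearMap.proj i, fun ω => ?_⟩
  simp only [sumOf, Finsupp.linearCombination_apply, Finsupp.sum, Finset.sum_apply,
    Pi.smul_apply, smul_eq_mul, sum_apply, smul_apply,
    ContinuousLinearMap.proj_apply, Finset.restrict]
  exact (Finset.sum_coe_sort (y s).support fun i => y s i * Z i ω).symm

/-- The process minus a multiple of the integral is jointly Gaussian with the integral, since both are mean
square limits of linear combinations of the values of the process. -/
lemma isGaussianProcess_sub_integral {Ω : Type*} [MeasurableSpace Ω] {P : Measure Ω}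
    [IsProbabilityMeasure P] {B : ℝ≥0 → Ω → ℝ} (hB_gauss : IsGaussianProcess B P) {T : ℝ≥0}
    (hT : 0 < T) {h : ℝ → ℝ} (hh : MemLp h 2 (volume.restrict (Icc 0 (T : ℝ))))
    {J : Ω → ℝ} (hJ : IsIntegral B P T h J) (r : Iic T → ℝ) :
    IsGaussianProcess (Sum.elim (fun (a : Iic T) ω => B a ω - r a * J ω) (fun _ : Unit => J)) P := by
  obtain ⟨x, -, hx⟩ := hJ.exists_seq hT hh
  have hB : ∀ t, MemLp (B t) 2 P := fun t => (hB_gauss.hasGaussianLaw_eval t).memLp_two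
  refine isGaussianProcess_of_tendsto
    (X := fun n s => sumOf (fun a : Iic T => B a)
      (Sum.elim (fun a => Finsupp.single a 1 - r a • x n) (fun _ : Unit => x n) s))
    (fun n => isGaussianProcess_sumOf (hB_gauss.comp_right _) _) ?_ ?_
  · rintro (a | _)
    · exact (hB a).sub (hJ.1.const_mul (r a))
    · exact hJ.1
  · rintro (a | _)
    · have heq : ∀ n, sumOf (fun a : Iic T => B a) (Finsupp.single a 1 - r a • x n) -
          (fun ω => B a ω - r a * J ω) =
          (-r a) • (sumOf (fun a : Iic T => B a) (x n) - J) := fun n => by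
        ext ω
        simp only [map_sub, map_smul, sumOf_single, Pi.sub_apply, Pi.smul_apply, smul_eq_mul]
        ring
      simp only [Sum.elim_inl, heq, eLpNorm_const_smul]
      simpa using ENNReal.Tendsto.const_mul (a := ‖-r a‖ₑ) hx (.inr enorm_ne_top)
    · exact hx

/-! ### Exponential tilting -/

/-- The Cameron–Martin formula on the line. -/
lemma gaussianReal_withDensity_exp {v : ℝ≥0} (hv : v ≠ 0) (θ : ℝ) :
    (gaussianReal 0 v).withDensity
      (fun j => ENNReal.ofReal (Real.exp (θ * j - θ ^ 2 / 2 * v))) = gaussianReal (θ * v) v := by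
  have hv' : (v : ℝ) ≠ 0 := by exact_mod_cast hv
  rw [gaussianReal_of_var_ne_zero _ hv, gaussianReal_of_var_ne_zero _ hv,
    ← withDensity_mul _ (measurable_gaussianPDF 0 v) (by fun_prop)]
  congr 1
  ext j
  simp only [Pi.mul_apply, gaussianPDF]
  rw [← ENNReal.ofReal_mul (gaussianPDFReal_nonneg _ _ _)]
  simp only [gaussianPDFReal]
  rw [mul_assoc, ← Real.exp_add]
  congr 3
  field_simp
  ring

lemma map_withDensity_comp {α β : Type*} [MeasurableSpace α] [MeasurableSpace β] (μ : Measure α)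
    {f : α → β} (hf : Measurable f) {g : β → ℝ≥0∞} (hg : Measurable g) :
    (μ.withDensity fun a => g (f a)).map f = (μ.map f).withDensity g := by
  ext s hs
  rw [Measure.map_apply hf hs, withDensity_apply _ (hf hs), withDensity_apply _ hs,
    setLIntegral_map hs hg hf]

/-- Let `(Y, J)` be independent with `J` centered Gaussian of variance `v ≠ 0`. Tilting the
probability by `exp (θ J - θ² v / 2)` has the same effect on the law of `(Y, J)` as adding
`θ v` to `J`. -/
lemma map_withDensity_exp_of_indepFun {Ω E : Type*} [MeasurableSpace Ω] [MeasurableSpace E]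
    {P : Measure Ω} [IsProbabilityMeasure P] {Y : Ω → E} {J : Ω → ℝ} (hY : Measurable Y)
    (hJ : Measurable J) (hYJ : IndepFun Y J P) {v : ℝ≥0} (hv : v ≠ 0)
    (hlaw : P.map J = gaussianReal 0 v) (θ : ℝ) :
    (P.withDensity fun ω => ENNReal.ofReal (Real.exp (θ * J ω - θ ^ 2 / 2 * v))).map
      (fun ω => (Y ω, J ω)) = P.map (fun ω => (Y ω, J ω + θ * v)) := by
  have h1 := (indepFun_iff_map_prod_eq_prod_map_map hY.aemeasurable hJ.aemeasurable).1 hYJ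
  have hsh : Measurable fun j : ℝ => j + θ * v := by fun_prop
  have h2 := (indepFun_iff_map_prod_eq_prod_map_map hY.aemeasurable
    (hsh.comp hJ).aemeasurable).1 (hYJ.comp measurable_id hsh)
  have h3 : P.map ((fun j : ℝ => j + θ * v) ∘ J) = gaussianReal (θ * v) v := by
    rw [← Measure.map_map hsh hJ, hlaw, gaussianReal_map_add_const, zero_add]
  rw [map_withDensity_comp P (hY.prodMk hJ)
    (g := fun z => ENNReal.ofReal (Real.exp (θ * z.2 - θ ^ 2 / 2 * v))) (by fun_prop), h1, hlaw]
  rw [h3] at h2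
  refine Eq.trans ?_ h2.symm
  rw [← gaussianReal_withDensity_exp hv, prod_withDensity_right (by fun_prop)]

/-- The likelihood ratio when the integral `J` is everywhere the value of the functional `Φ` at the
path. With `v = Var J` and `Y a = B a - (a / v) J`, the path is `a ↦ Y a + (a / v) J`, and adding the
drift `θ a` amounts to replacing `J` by `J + θ v`; as `Y` and `J` are independent, this has the
same effect on the law as an exponential tilting in `J`. -/
lemma lawX_eq_withDensity {Ω : Type*} [MeasurableSpace Ω] {P : Measure Ω} [IsProbabilityMeasure P]
    {B : ℝ≥0 → Ω → ℝ} (hB_meas : ∀ t, Measurable (B t)) (hB_gauss : IsGaussianProcess B P)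
    (hB_centered : ∀ t, ∫ ω, B t ω ∂P = 0) {T : ℝ≥0} (hT : 0 < T) {h : ℝ → ℝ}
    (hh : MemLp h 2 (volume.restrict (Icc 0 (T : ℝ)))) {Φ : (Iic T → ℝ) → ℝ} (hΦ : Measurable Φ)
    (hJ : IsIntegral B P T h fun ω => Φ (pathX B T 0 ω))
    (hBJ : ∀ a : Iic T, ∫ ω, B a ω * Φ (pathX B T 0 ω) ∂P = (a : ℝ≥0)) (θ : ℝ) :
    lawX B P T θ = (lawX B P T 0).withDensity (fun x => ENNReal.ofReal
      (Real.exp (θ * Φ x - θ ^ 2 / 2 * ∫ s in Icc 0 (T : ℝ), h s))) := by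
  have hB : ∀ t, MemLp (B t) 2 P := fun t => (hB_gauss.hasGaussianLaw_eval t).memLp_two
  have hp := measurable_pathX hB_meas T 0
  set J : Ω → ℝ := fun ω => Φ (pathX B T 0 ω)
  have hJm : Measurable J := hΦ.comp hp
  have hJJ := integral_isIntegral_mul_self hT hB hh hJ hBJ
  have hJ0 := integral_isIntegral hT hB hB_centered hh hJ
  obtain ⟨v, hv⟩ : ∃ v : ℝ≥0, (v : ℝ) = ∫ s in Icc 0 (T : ℝ), h s :=
    ⟨⟨_, hJJ ▸ integral_nonneg fun ω => mul_self_nonneg _⟩, rfl⟩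
  rw [← hv] at hJJ ⊢
  -- A degenerate `J` would be orthogonal to `B T`, whereas their covariance is `T`
  have hv0 : v ≠ 0 := by
    rintro rfl
    have hJz : J =ᵐ[P] 0 := by
      have := (integral_eq_zero_iff_of_nonneg (fun ω => mul_self_nonneg (J ω))
        (hJ.1.integrable_mul hJ.1)).1 (by simpa using hJJ)
      filter_upwards [this] with ω hω using by simpa using hω
    have h0 : ∫ ω, B T ω * J ω ∂P = 0 := integral_eq_zero_of_ae (by
      filter_upwards [hJz] with ω hω
      simp [hω])
    have hBT := hBJ ⟨T, mem_Iic.2 le_rfl⟩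
    rw [h0] at hBT
    exact hT.ne (by exact_mod_cast hBT)
  have hv0' : (v : ℝ) ≠ 0 := by exact_mod_cast hv0
  set Y : Iic T → Ω → ℝ := fun a ω => B a ω - ((a : ℝ≥0) : ℝ) / v * J ω
  have hYm : ∀ a, Measurable (Y a) := fun a => (hB_meas a).sub (hJm.const_mul _)
  have hG := isGaussianProcess_sub_integral hB_gauss hT hh hJ fun a => ((a : ℝ≥0) : ℝ) / v
  have hind : IndepFun (fun ω a => Y a ω) (fun ω (_ : Unit) => J ω) P := by
    refine hG.indepFun_of_covariance_eq_zero (fun a => (hYm a).aemeasurable)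
      (fun _ => hJm.aemeasurable) fun a _ => ?_
    have hYL : MemLp (Y a) 2 P := (hB a).sub (hJ.1.const_mul _)
    rw [covariance_eq_sub hYL hJ.1, hJ0, mul_zero, sub_zero]
    simp only [Y, Pi.mul_apply, sub_mul, mul_assoc]
    have i1 : Integrable (fun ω => B a ω * J ω) P := (hB a).integrable_mul hJ.1
    have i2 : Integrable (fun ω => J ω * J ω) P := hJ.1.integrable_mul hJ.1
    rw [integral_sub i1 (i2.const_mul _), integral_const_mul, hBJ, hJJ]
    field_simp
    ring
  have hind' : IndepFun (fun ω a => Y a ω) J P :=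
    hind.comp measurable_id (measurable_pi_apply ())
  have hlaw : P.map J = gaussianReal 0 v := by
    have hJG : HasGaussianLaw J P := hG.hasGaussianLaw_eval (.inr ())
    rw [hJG.map_eq_gaussianReal, hJ0, variance_eq_sub hJ.1, hJ0]
    simp [sq, hJJ]
  have htilt := map_withDensity_exp_of_indepFun (measurable_pi_lambda _ hYm) hJm hind' hv0 hlaw θ
  -- The path is a measurable function of the pair `(Y, J)`, for which the drift is a shift of `J`
  let m : (Iic T → ℝ) × ℝ → Iic T → ℝ := fun z a => z.1 a + ((a : ℝ≥0) : ℝ) / v * z.2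
  have hm : Measurable m := by fun_prop
  have h1 : (m ∘ fun ω => ((fun a => Y a ω), J ω)) = pathX B T 0 := by
    ext ω a
    simp [m, Y, pathX]
  have h2 : (m ∘ fun ω => ((fun a => Y a ω), J ω + θ * v)) = pathX B T θ := by
    ext ω a
    simp only [Function.comp, m, Y, pathX]
    field_simp
    ring
  have hpair : Measurable fun ω => ((fun a => Y a ω), J ω) :=
    (measurable_pi_lambda _ hYm).prodMk hJm
  have hpair' : Measurable fun ω => ((fun a => Y a ω), J ω + θ * v) :=
    (measurable_pi_lambda _ hYm).prodMk (hJm.add_const _)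
  rw [lawX, lawX, ← h2, ← Measure.map_map hm hpair', ← htilt, Measure.map_map hm hpair, h1,
    ← map_withDensity_comp P hp (by fun_prop)]

end GaussDrift

theorem mainTheorem1 {Ω : Type*} [MeasurableSpace Ω] (P : Measure Ω) [IsProbabilityMeasure P]
    (B : ℝ≥0 → Ω → ℝ)
    (hB_meas : ∀ t, Measurable (B t))
    (hB_gauss : IsGaussianProcess B P)
    (hB_centered : ∀ t, ∫ ω, B t ω ∂P = 0)
    (hB_stat : GaussDrift.HasStationaryIncrements B P)
    (hB_zero : ∀ᵐ ω ∂P, B 0 ω = 0)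
    (T : ℝ≥0) (hT : 0 < T)
    (hB_nonsing : GaussDrift.NonsingularFDD B P T)
    (K : ℝ → ℝ)
    (hK_even : ∀ x, K (-x) = K x)
    (hK_int : IntegrableOn K (Icc (-(T : ℝ)) (T : ℝ)))
    (hK_cov : GaussDrift.HasMixedDeriv (GaussDrift.covFun B P) (fun t s => K (t - s)) (T : ℝ))
    (h : ℝ → ℝ)
    (hh_L2 : MemLp h 2 (volume.restrict (Icc 0 (T : ℝ))))
    (hh_eq : ∀ᵐ t ∂(volume.restrict (Icc 0 (T : ℝ))), GaussDrift.gammaOp K (T : ℝ) h t = 1) :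
    (∃ J : Ω → ℝ, GaussDrift.IsIntegral B P T h J) ∧
    ∀ J : Ω → ℝ, GaussDrift.IsIntegral B P T h J →
      ∃ Φ : (Iic T → ℝ) → ℝ, Measurable Φ ∧
        (∀ᵐ ω ∂P, Φ (GaussDrift.pathX B T 0 ω) = J ω) ∧
        ∀ θ : ℝ, GaussDrift.lawX B P T θ =
          (GaussDrift.lawX B P T 0).withDensity (fun x => ENNReal.ofReal
            (Real.exp (θ * Φ x - θ ^ 2 / 2 * ∫ s in Icc 0 (T : ℝ), h s))) := by
  have hB : ∀ t, MemLp (B t) 2 P := fun t => (hB_gauss.hasGaussianLaw_eval t).memLp_two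
  obtain ⟨c, hc, hbound⟩ := GaussDrift.exists_eLpNorm_sumOf_le hB hB_zero hK_even hK_int hK_cov
  refine ⟨GaussDrift.exists_isIntegral hT hB hc hbound hh_L2, fun J hJ => ?_⟩
  obtain ⟨Φ, hΦ, hΦJ⟩ := hJ.exists_functional hT hB_meas hh_L2
  have hJ' : GaussDrift.IsIntegral B P T h fun ω => Φ (GaussDrift.pathX B T 0 ω) :=
    hJ.congr (hΦJ.mono fun ω hω => hω.symm)
  exact ⟨Φ, hΦ, hΦJ, GaussDrift.lawX_eq_withDensity hB_meas hB_gauss hB_centered hT hh_L2 hΦ hJ'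
    (GaussDrift.integral_mul_isIntegral hT hB hB_zero hK_int hK_cov hh_L2 hh_eq hJ')⟩
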